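/- Let $(\Omega,\mathcal F,\mathbb P)$ be a probability space, let $0<\tau\le\frac12$ and $\beta=\frac{1-\tau}{\tau}\ge 1$, and let $\xi\in L^\infty(\Omega,\mathcal F,\mathbb P)$ be real valued. Let $e_\tau(\xi)$ denote the $\tau$-expectile of $\xi$, i.e. the unique minimiser over $l\in\mathbb R$ of $$\phi_{\tau,\xi}(l)=\tau\,\mathbb E\big[((\xi-l)^+)^2\big]+(1-\tau)\,\mathbb E\big[((l-\xi)^+)^2\big].$$ Let $q$ be a quantile function of $\xi$, i.e. a function $u\mapsto q_u$ on $]0,1[$ with $\mathbb P[\xi<q_u]\le u\le\mathbb P[\xi\le q_u]$ for all $u\in\,]0,1[$. Let $\mathcal F_\beta$ be the set of convex functions $f\colon[0,1]\to[0,1]$ with $f(0)=0$, $f(1)=1$ and $f'(1)\le\beta f'(0)$, where $f'(0)$ is the right derivative of $f$ at $0$ and $f'(1)$ is the left derivative of $f$ at $1$ (the condition includes that $f'(1)$ is finite). Then the minimiser $e_\tau(\xi)$ exists and is unique, $\mathcal F_\beta$ is convex, for every $f\in\mathcal F_\beta$ the function $u\mapsto q_u f'(1-u)$ (defined for almost every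 $u$) is integrable on $[0,1]$, and $$e_\tau(\xi)=\inf\left\{\int_0^1 q_u\,f'(1-u)\,du\ \middle|\ f\in\mathcal F_\beta\right\}.$$ -/

import Mathlib

open MeasureTheory Set

/-- The asymmetric quadratic loss
`φ_{τ,ξ}(l) = τ E[((ξ - l)⁺)²] + (1 - τ) E[((l - ξ)⁺)²]`. -/
noncomputable def expectileLoss {Ω : Type*} [MeasurableSpace Ω] (P : Measure Ω)
    (τ : ℝ) (ξ : Ω → ℝ) (l : ℝ) : ℝ :=
  τ * (∫ ω, (max (ξ ω - l) 0) ^ 2 ∂P) + (1 - τ) * (∫ ω, (max (l - ξ ω) 0) ^ 2 ∂P)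

/-- The expectile `e_τ(ξ)`: the point at which the loss `φ_{τ,ξ}` attains its minimum over `ℝ`. -/
noncomputable def expectile {Ω : Type*} [MeasurableSpace Ω] (P : Measure Ω)
    (τ : ℝ) (ξ : Ω → ℝ) : ℝ :=
  Classical.epsilon fun e : ℝ => ∀ l : ℝ, expectileLoss P τ ξ e ≤ expectileLoss P τ ξ l

/-- `q` is a quantile function of `ξ`: for every `u ∈ ]0,1[` the number `q u` is a `u`-quantile of
`ξ`, that is `P[ξ < q u] ≤ u ≤ P[ξ ≤ q u]`. Values of `q` outside `]0,1[` are irrelevant. -/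
def IsQuantileFunction {Ω : Type*} [MeasurableSpace Ω] (P : Measure Ω)
    (ξ : Ω → ℝ) (q : ℝ → ℝ) : Prop :=
  ∀ u ∈ Ioo (0 : ℝ) 1, P.real {ω | ξ ω < q u} ≤ u ∧ u ≤ P.real {ω | ξ ω ≤ q u}

/-- The set `ℱ_β` of convex distortions `f : [0,1] → [0,1]` with `f 0 = 0`, `f 1 = 1` and
`f'(1) ≤ β f'(0)`. Here `f'(0)` is the right derivative at `0` and `f'(1)` the left derivative at
`1`; a convex `f` whose left derivative at `1` is `+∞` does not satisfy the inequality, and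
accordingly does not belong to the set. Only the values of `f` on `[0,1]` matter. -/
def distortionSet (β : ℝ) : Set (ℝ → ℝ) :=
  {f | ConvexOn ℝ (Icc 0 1) f ∧ MapsTo f (Icc 0 1) (Icc 0 1) ∧ f 0 = 0 ∧ f 1 = 1 ∧
    ∃ d₀ d₁ : ℝ, HasDerivWithinAt f d₀ (Icc 0 1) 0 ∧ HasDerivWithinAt f d₁ (Icc 0 1) 1 ∧
      d₁ ≤ β * d₀}

/-! ### Quantile functions -/

section Quantile

variable {Ω : Type*} [MeasurableSpace Ω] {P : Measure Ω} [IsProbabilityMeasure P]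
  {ξ : Ω → ℝ} {q : ℝ → ℝ}

/-! The loss is strongly convex, and its stationarity condition is `E[(ξ - e)⁺] = β E[(e - ξ)⁺]`.
Under the uniform law `q` is distributed as `ξ` (`IsQuantileFunction.map_eq`), so `∫ (q - e)⁺ = β ∫
(e - q)⁺`.

For a distortion `f`, the weight `f'(1 - u)` has integral 1 and lies between `d₀ = f'(0)` and `d₁ =
f'(1) ≤ β d₀`. Hence `∫ q f'(1 - u) - e = ∫ (q - e) f'(1 - u) ≥ d₀ ∫ (q - e)⁺ - d₁ ∫ (e - q)⁺ = (β
d₀ - d₁) ∫ (e - q)⁺ ≥ 0` (`le_integral_quantile_mul_derivWithin`).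

Equality holds if the weight is `β d₀` below `e` and `d₀` above. As `q` is monotone, a convex `f`
with two slopes achieves this (`exists_distortion_integral_eq`), so the infimum is attained. -/

theorem IsQuantileFunction.le_of_lt (hq : IsQuantileFunction P ξ q) {u x : ℝ}
    (hu : u ∈ Ioo (0 : ℝ) 1) (h : q u < x) : u ≤ P.real {ω | ξ ω < x} :=
  (hq u hu).2.trans (measureReal_mono fun _ hω => lt_of_le_of_lt hω h)

theorem IsQuantileFunction.le_of_le (hq : IsQuantileFunction P ξ q) {u x : ℝ}
    (hu : u ∈ Ioo (0 : ℝ) 1) (h : q u ≤ x) : u ≤ P.real {ω | ξ ω ≤ x} :=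
  (hq u hu).2.trans (measureReal_mono fun _ hω => le_trans hω h)

theorem IsQuantileFunction.ge_of_lt (hq : IsQuantileFunction P ξ q) {u x : ℝ}
    (hu : u ∈ Ioo (0 : ℝ) 1) (h : x < q u) : P.real {ω | ξ ω ≤ x} ≤ u :=
  (measureReal_mono fun _ hω => lt_of_le_of_lt hω h).trans (hq u hu).1

theorem IsQuantileFunction.monotoneOn (hq : IsQuantileFunction P ξ q) :
    MonotoneOn q (Ioo 0 1) := by
  intro u hu v hv huv
  rcases huv.eq_or_lt with rfl | huv
  · exact le_rfl
  by_contra! h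
  have h1 := hq.ge_of_lt hu h
  have h2 := (hq v hv).2
  linarith

theorem IsQuantileFunction.aemeasurable (hq : IsQuantileFunction P ξ q) :
    AEMeasurable q (volume.restrict (Ioo (0 : ℝ) 1)) :=
  aemeasurable_restrict_of_monotoneOn measurableSet_Ioo hq.monotoneOn

/-- A quantile function pushes the uniform distribution to the law of the random variable. -/
theorem IsQuantileFunction.map_eq (hq : IsQuantileFunction P ξ q) (hξ : AEMeasurable ξ P) :
    (volume.restrict (Ioo (0 : ℝ) 1)).map q = P.map ξ := by
  have : IsProbabilityMeasure (volume.restrict (Ioo (0 : ℝ) 1)) := ⟨by simp⟩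
  have := Measure.isProbabilityMeasure_map hq.aemeasurable
  have := Measure.isProbabilityMeasure_map hξ
  refine Measure.ext_of_Iic _ _ fun x => ?_
  have hF1 : P.real {ω | ξ ω ≤ x} ≤ 1 := measureReal_le_one
  have hF0 : 0 ≤ P.real {ω | ξ ω ≤ x} := measureReal_nonneg
  rw [Measure.map_apply_of_aemeasurable hq.aemeasurable measurableSet_Iic,
    Measure.map_apply_of_aemeasurable hξ measurableSet_Iic]
  have hR : P (ξ ⁻¹' Iic x) = ENNReal.ofReal (P.real {ω | ξ ω ≤ x}) := by
    rw [ofReal_measureReal]; rfl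
  rw [hR, Measure.restrict_apply' measurableSet_Ioo]
  -- With `F x = P[ξ ≤ x]`, the set `{q ≤ x}` lies between `Ioo 0 (F x)` and `Ioc 0 (F x)`,
  -- whichever quantiles `q` selects.
  apply le_antisymm
  · calc volume (q ⁻¹' Iic x ∩ Ioo 0 1) ≤ volume (Ioc 0 (P.real {ω | ξ ω ≤ x})) :=
          measure_mono fun u hu => ⟨hu.2.1, hq.le_of_le hu.2 hu.1⟩
      _ = _ := by simp
  · calc ENNReal.ofReal (P.real {ω | ξ ω ≤ x}) = volume (Ioo 0 (P.real {ω | ξ ω ≤ x})) := by simp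
      _ ≤ _ := by
        refine measure_mono fun u hu => ?_
        have hu1 : u ∈ Ioo (0 : ℝ) 1 := ⟨hu.1, hu.2.trans_le hF1⟩
        refine ⟨?_, hu1⟩
        by_contra h
        exact absurd hu.2 (not_lt.2 (hq.ge_of_lt hu1 (not_le.1 h)))

theorem IsQuantileFunction.integral_comp (hq : IsQuantileFunction P ξ q) (hξ : AEMeasurable ξ P)
    {φ : ℝ → ℝ} (hφ : Measurable φ) :
    ∫ u in Ioo (0 : ℝ) 1, φ (q u) = ∫ ω, φ (ξ ω) ∂P := by
  rw [← integral_map hq.aemeasurable hφ.aestronglyMeasurable, hq.map_eq hξ,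
    integral_map hξ hφ.aestronglyMeasurable]

theorem IsQuantileFunction.ae_norm_le (hq : IsQuantileFunction P ξ q) (hξ : AEMeasurable ξ P)
    {M : ℝ} (hM : ∀ᵐ ω ∂P, ‖ξ ω‖ ≤ M) :
    ∀ᵐ u ∂(volume.restrict (Ioo (0 : ℝ) 1)), ‖q u‖ ≤ M := by
  have hs : MeasurableSet {x : ℝ | ‖x‖ ≤ M} := measurableSet_le measurable_norm measurable_const
  have h : ∀ᵐ x ∂(P.map ξ), ‖x‖ ≤ M := (ae_map_iff hξ hs).2 hM
  rw [← hq.map_eq hξ] at h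
  exact (ae_map_iff hq.aemeasurable hs).1 h

end Quantile

/-! ### The expectile and its first-order condition -/

theorem exists_ae_norm_le_of_memLp_top {Ω : Type*} [MeasurableSpace Ω] {P : Measure Ω}
    {ξ : Ω → ℝ} (hξ : MemLp ξ ⊤ P) : ∃ M : ℝ, ∀ᵐ ω ∂P, ‖ξ ω‖ ≤ M := by
  have h := hξ.2
  rw [eLpNorm_exponent_top] at h
  refine ⟨(eLpNormEssSup ξ P).toReal, ?_⟩
  filter_upwards [ae_le_eLpNormEssSup (f := ξ) (μ := P)] with ω hω
  have := ENNReal.toReal_mono h.ne hω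
  simpa using this

section Expectile

variable {Ω : Type*} [MeasurableSpace Ω] {P : Measure Ω} [IsProbabilityMeasure P]
  {ξ : Ω → ℝ} {τ e : ℝ}

theorem memLp_top_max_sub_right (hξ : MemLp ξ ⊤ P) (l : ℝ) :
    MemLp (fun ω => max (ξ ω - l) 0) ⊤ P :=
  (hξ.sub (memLp_const l)).pos_part

theorem memLp_top_max_sub_left (hξ : MemLp ξ ⊤ P) (l : ℝ) :
    MemLp (fun ω => max (l - ξ ω) 0) ⊤ P :=
  ((memLp_const l).sub hξ).pos_part

theorem integrable_max_sub_right (hξ : MemLp ξ ⊤ P) (l : ℝ) :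
    Integrable (fun ω => max (ξ ω - l) 0) P :=
  (memLp_top_max_sub_right hξ l).integrable le_top

theorem integrable_max_sub_left (hξ : MemLp ξ ⊤ P) (l : ℝ) :
    Integrable (fun ω => max (l - ξ ω) 0) P :=
  (memLp_top_max_sub_left hξ l).integrable le_top

/-- Intermediate value theorem on `[-M, M]`: one of the two integrals vanishes at each endpoint, so
their weighted difference changes sign. -/
theorem exists_first_order_condition (hξ : MemLp ξ ⊤ P) (hτ₀ : 0 < τ) (hτ₁ : τ ≤ 1) :
    ∃ e : ℝ, τ * ∫ ω, max (ξ ω - e) 0 ∂P = (1 - τ) * ∫ ω, max (e - ξ ω) 0 ∂P := by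
  obtain ⟨M, hM⟩ := exists_ae_norm_le_of_memLp_top hξ
  have hM0 : 0 ≤ M := by
    obtain ⟨ω, hω⟩ := hM.exists
    exact (norm_nonneg _).trans hω
  have hc1 : ContinuousOn (fun l : ℝ => ∫ ω, max (ξ ω - l) 0 ∂P) (Icc (-M) M) := by
    refine continuousOn_of_dominated (bound := fun _ => 2 * M)
      (fun l _ => (integrable_max_sub_right hξ l).1) (fun l hl => ?_) (integrable_const _)
      (Filter.Eventually.of_forall fun ω => by fun_prop)
    filter_upwards [hM] with ω hω
    rw [Real.norm_eq_abs, abs_le] at hω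
    rw [Real.norm_of_nonneg (le_max_right _ _)]
    exact max_le (by linarith [hl.1]) (by linarith)
  have hc2 : ContinuousOn (fun l : ℝ => ∫ ω, max (l - ξ ω) 0 ∂P) (Icc (-M) M) := by
    refine continuousOn_of_dominated (bound := fun _ => 2 * M)
      (fun l _ => (integrable_max_sub_left hξ l).1) (fun l hl => ?_) (integrable_const _)
      (Filter.Eventually.of_forall fun ω => by fun_prop)
    filter_upwards [hM] with ω hω
    rw [Real.norm_eq_abs, abs_le] at hω
    rw [Real.norm_of_nonneg (le_max_right _ _)]
    exact max_le (by linarith [hl.2]) (by linarith)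
  have hc := (hc2.const_mul (1 - τ)).sub (hc1.const_mul τ)
  have hn1 : ∫ ω, max (-M - ξ ω) 0 ∂P = 0 := by
    refine integral_eq_zero_of_ae ?_
    filter_upwards [hM] with ω hω
    rw [Real.norm_eq_abs, abs_le] at hω
    exact max_eq_right (by linarith)
  have hn2 : ∫ ω, max (ξ ω - M) 0 ∂P = 0 := by
    refine integral_eq_zero_of_ae ?_
    filter_upwards [hM] with ω hω
    rw [Real.norm_eq_abs, abs_le] at hω
    exact max_eq_right (by linarith)
  have h1 : 0 ≤ ∫ ω, max (ξ ω - -M) 0 ∂P := integral_nonneg fun _ => le_max_right _ _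
  have h2 : 0 ≤ ∫ ω, max (M - ξ ω) 0 ∂P := integral_nonneg fun _ => le_max_right _ _
  have h3 := mul_nonneg hτ₀.le h1
  have h4 := mul_nonneg (sub_nonneg.2 hτ₁) h2
  have hlo : (1 - τ) * (∫ ω, max (-M - ξ ω) 0 ∂P) - τ * ∫ ω, max (ξ ω - -M) 0 ∂P ≤ 0 := by
    rw [hn1]; linarith
  have hhi : 0 ≤ (1 - τ) * (∫ ω, max (M - ξ ω) 0 ∂P) - τ * ∫ ω, max (ξ ω - M) 0 ∂P := by
    rw [hn2]; linarith
  obtain ⟨e, -, he⟩ := intermediate_value_Icc (by linarith : -M ≤ M) hc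
    (show (0 : ℝ) ∈ Icc _ _ from ⟨hlo, hhi⟩)
  exact ⟨e, (sub_eq_zero.1 he).symm⟩

/-- The right side, as a function of `l`, has curvature `2τ` or `2(1 - τ)`, both at least `2τ`, so
it exceeds its tangent at `e` by at least `τ (l - e) ^ 2`. -/
theorem asymmetric_square_lower_bound (hτ₁ : τ ≤ 1 / 2) (x e l : ℝ) :
    τ * (max (x - e) 0) ^ 2 + (1 - τ) * (max (e - x) 0) ^ 2
      + (2 * (l - e)) * ((1 - τ) * max (e - x) 0 - τ * max (x - e) 0) + τ * (l - e) ^ 2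
      ≤ τ * (max (x - l) 0) ^ 2 + (1 - τ) * (max (l - x) 0) ^ 2 := by
  rcases le_total x e with h1 | h1 <;> rcases le_total x l with h2 | h2
  · rw [max_eq_right (sub_nonpos.2 h1), max_eq_left (sub_nonneg.2 h1),
      max_eq_right (sub_nonpos.2 h2), max_eq_left (sub_nonneg.2 h2)]
    nlinarith [mul_nonneg (by linarith : 0 ≤ 1 - 2 * τ) (sq_nonneg (l - e))]
  · rw [max_eq_right (sub_nonpos.2 h1), max_eq_left (sub_nonneg.2 h1),
      max_eq_left (sub_nonneg.2 h2), max_eq_right (sub_nonpos.2 h2)]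
    nlinarith [mul_nonneg (by linarith : 0 ≤ 1 - 2 * τ)
      (mul_nonneg (sub_nonneg.2 h1) (by linarith : 0 ≤ (e - x) + 2 * (x - l)))]
  · rw [max_eq_left (sub_nonneg.2 h1), max_eq_right (sub_nonpos.2 h1),
      max_eq_right (sub_nonpos.2 h2), max_eq_left (sub_nonneg.2 h2)]
    nlinarith [mul_nonneg (by linarith : 0 ≤ 1 - 2 * τ) (sq_nonneg (l - x))]
  · rw [max_eq_left (sub_nonneg.2 h1), max_eq_right (sub_nonpos.2 h1),
      max_eq_left (sub_nonneg.2 h2), max_eq_right (sub_nonpos.2 h2)]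
    nlinarith

/-- After integration the tangent term vanishes by `he`. The quadratic gap gives both minimality and
uniqueness of `e`. -/
theorem expectileLoss_lower_bound (hξ : MemLp ξ ⊤ P) (hτ₁ : τ ≤ 1 / 2)
    (he : τ * ∫ ω, max (ξ ω - e) 0 ∂P = (1 - τ) * ∫ ω, max (e - ξ ω) 0 ∂P) (l : ℝ) :
    expectileLoss P τ ξ e + τ * (l - e) ^ 2 ≤ expectileLoss P τ ξ l := by
  have hR : ∀ l, Integrable (fun ω => (max (ξ ω - l) 0) ^ 2) P := fun l =>
    ((memLp_top_max_sub_right hξ l).mono_exponent le_top).integrable_sq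
  have hL : ∀ l, Integrable (fun ω => (max (l - ξ ω) 0) ^ 2) P := fun l =>
    ((memLp_top_max_sub_left hξ l).mono_exponent le_top).integrable_sq
  have hQ : ∀ l, Integrable
      (fun ω => τ * (max (ξ ω - l) 0) ^ 2 + (1 - τ) * (max (l - ξ ω) 0) ^ 2) P :=
    fun l => ((hR l).const_mul _).add ((hL l).const_mul _)
  have hloss : ∀ l, expectileLoss P τ ξ l =
      ∫ ω, (τ * (max (ξ ω - l) 0) ^ 2 + (1 - τ) * (max (l - ξ ω) 0) ^ 2) ∂P := fun l => by
    rw [integral_add ((hR l).const_mul _) ((hL l).const_mul _), integral_const_mul,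
      integral_const_mul, expectileLoss]
  have hD : Integrable (fun ω => (1 - τ) * max (e - ξ ω) 0 - τ * max (ξ ω - e) 0) P :=
    ((integrable_max_sub_left hξ e).const_mul _).sub ((integrable_max_sub_right hξ e).const_mul _)
  have hD0 : ∫ ω, ((1 - τ) * max (e - ξ ω) 0 - τ * max (ξ ω - e) 0) ∂P = 0 := by
    rw [integral_sub ((integrable_max_sub_left hξ e).const_mul _)
      ((integrable_max_sub_right hξ e).const_mul _), integral_const_mul, integral_const_mul, he,
      sub_self]
  have h := integral_mono (((hQ e).add (hD.const_mul (2 * (l - e)))).add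
    (integrable_const (τ * (l - e) ^ 2))) (hQ l)
    (fun ω => asymmetric_square_lower_bound hτ₁ (ξ ω) e l)
  rw [integral_add' ((hQ e).add (hD.const_mul (2 * (l - e)))) (integrable_const _),
    integral_add' (hQ e) (hD.const_mul _), integral_const_mul, hD0, ← hloss, ← hloss] at h
  simpa using h

theorem expectile_eq_of_first_order_condition (hξ : MemLp ξ ⊤ P) (hτ₀ : 0 < τ) (hτ₁ : τ ≤ 1 / 2)
    (he : τ * ∫ ω, max (ξ ω - e) 0 ∂P = (1 - τ) * ∫ ω, max (e - ξ ω) 0 ∂P) :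
    expectile P τ ξ = e := by
  have hlow := expectileLoss_lower_bound hξ hτ₁ he
  -- `Classical.epsilon` satisfies its predicate only once some minimiser is known; `e` serves.
  have hmin : ∀ l, expectileLoss P τ ξ (expectile P τ ξ) ≤ expectileLoss P τ ξ l :=
    Classical.epsilon_spec (p := fun e : ℝ => ∀ l : ℝ, expectileLoss P τ ξ e ≤ expectileLoss P τ ξ l)
      ⟨e, fun l => by nlinarith [hlow l, mul_nonneg hτ₀.le (sq_nonneg (l - e))]⟩
  have h : τ * (expectile P τ ξ - e) ^ 2 ≤ 0 := by linarith [hlow (expectile P τ ξ), hmin e]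
  have h2 : (expectile P τ ξ - e) ^ 2 = 0 :=
    le_antisymm (nonpos_of_mul_nonpos_right h hτ₀) (sq_nonneg _)
  exact sub_eq_zero.1 (pow_eq_zero_iff two_ne_zero |>.1 h2)

end Expectile

/-! ### Convex distortions -/

section Distortion

variable {f : ℝ → ℝ} {d₀ d₁ : ℝ}

theorem ConvexOn.mul_sub_le_of_hasDerivWithinAt_left (hf : ConvexOn ℝ (Icc 0 1) f)
    (h0 : HasDerivWithinAt f d₀ (Icc 0 1) 0) {x y : ℝ} (hx : x ∈ Icc (0 : ℝ) 1)
    (hy : y ∈ Icc (0 : ℝ) 1) (hxy : x < y) : d₀ * (y - x) ≤ f y - f x := by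
  have hz : (0 : ℝ) ∈ Icc (0 : ℝ) 1 := by simp
  rw [← le_div_iff₀ (sub_pos.2 hxy)]
  rcases hx.1.eq_or_lt with rfl | hx0
  · simpa [slope_def_field] using hf.le_slope_of_hasDerivWithinAt hz hy hxy h0
  · have h1 := hf.le_slope_of_hasDerivWithinAt hz hx hx0 h0
    rw [slope_def_field] at h1
    exact h1.trans (hf.slope_mono_adjacent hz hy hx0 hxy)

theorem ConvexOn.sub_le_mul_of_hasDerivWithinAt_right (hf : ConvexOn ℝ (Icc 0 1) f)
    (h1 : HasDerivWithinAt f d₁ (Icc 0 1) 1) {x y : ℝ} (hx : x ∈ Icc (0 : ℝ) 1)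
    (hy : y ∈ Icc (0 : ℝ) 1) (hxy : x < y) : f y - f x ≤ d₁ * (y - x) := by
  have hz : (1 : ℝ) ∈ Icc (0 : ℝ) 1 := by simp
  rw [← div_le_iff₀ (sub_pos.2 hxy)]
  rcases hy.2.eq_or_lt with rfl | hy1
  · simpa [slope_def_field] using hf.slope_le_of_hasDerivWithinAt hx hz hxy h1
  · have h2 := hf.slope_le_of_hasDerivWithinAt hy hz hy1 h1
    rw [slope_def_field] at h2
    exact (hf.slope_mono_adjacent hx hz hxy hy1).trans h2

/-- The finite end slopes bound every chord, so `f` is Lipschitz up to the endpoints. This supplies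
almost everywhere differentiability and the fundamental theorem of calculus. -/
theorem ConvexOn.absolutelyContinuousOnInterval (hf : ConvexOn ℝ (Icc 0 1) f)
    (h0 : HasDerivWithinAt f d₀ (Icc 0 1) 0) (h1 : HasDerivWithinAt f d₁ (Icc 0 1) 1) :
    AbsolutelyContinuousOnInterval f 0 1 := by
  have hK : LipschitzOnWith (Real.toNNReal (|d₀| + |d₁|)) f (uIcc 0 1) := by
    rw [uIcc_of_le zero_le_one]
    refine LipschitzOnWith.of_le_add_mul _ fun x hx y hy => ?_
    rw [Real.coe_toNNReal _ (by positivity), Real.dist_eq]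
    rcases lt_trichotomy x y with h | rfl | h
    · have := hf.mul_sub_le_of_hasDerivWithinAt_left h0 hx hy h
      rw [abs_of_neg (sub_neg.2 h)]
      nlinarith [neg_abs_le d₀, abs_nonneg d₁]
    · simp
    · have := hf.sub_le_mul_of_hasDerivWithinAt_right h1 hy hx h
      rw [abs_of_pos (sub_pos.2 h)]
      nlinarith [le_abs_self d₁, abs_nonneg d₀]
  exact hK.absolutelyContinuousOnInterval

theorem ConvexOn.ae_deriv_mem_Icc (hf : ConvexOn ℝ (Icc 0 1) f)
    (h0 : HasDerivWithinAt f d₀ (Icc 0 1) 0) (h1 : HasDerivWithinAt f d₁ (Icc 0 1) 1) :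
    ∀ᵐ x : ℝ, x ∈ Ioo (0 : ℝ) 1 → deriv f x ∈ Icc d₀ d₁ := by
  filter_upwards [(hf.absolutelyContinuousOnInterval h0 h1).ae_differentiableAt] with x hx hx01
  have hxI : x ∈ Icc (0 : ℝ) 1 := Ioo_subset_Icc_self hx01
  have hd := (hx (by rwa [uIcc_of_le zero_le_one])).hasDerivAt.hasDerivWithinAt (s := Icc 0 1)
  have hz : (0 : ℝ) ∈ Icc (0 : ℝ) 1 := by simp
  have ho : (1 : ℝ) ∈ Icc (0 : ℝ) 1 := by simp
  exact ⟨(hf.le_slope_of_hasDerivWithinAt hz hxI hx01.1 h0).trans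
      (hf.slope_le_of_hasDerivWithinAt hz hxI hx01.1 hd),
    (hf.le_slope_of_hasDerivWithinAt hxI ho hx01.2 hd).trans
      (hf.slope_le_of_hasDerivWithinAt hxI ho hx01.2 h1)⟩

theorem one_sub_mem_Ioo {u : ℝ} (hu : u ∈ Ioo (0 : ℝ) 1) : 1 - u ∈ Ioo (0 : ℝ) 1 :=
  ⟨by linarith [hu.2], by linarith [hu.1]⟩

theorem derivWithin_reflect_eq {u : ℝ} (hu : u ∈ Ioo (0 : ℝ) 1) :
    derivWithin f (Icc 0 1) (1 - u) = deriv f (1 - u) :=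
  derivWithin_of_mem_nhds (Icc_mem_nhds (one_sub_mem_Ioo hu).1 (one_sub_mem_Ioo hu).2)

/-- No regularity of `f` is needed, since `deriv f` is always measurable. -/
theorem aestronglyMeasurable_derivWithin_reflect :
    AEStronglyMeasurable (fun u => derivWithin f (Icc 0 1) (1 - u))
      (volume.restrict (Ioo (0 : ℝ) 1)) := by
  refine AEStronglyMeasurable.congr (f := fun u => deriv f (1 - u))
    ((measurable_deriv f).comp (measurable_const.sub measurable_id)).aestronglyMeasurable ?_
  filter_upwards [ae_restrict_mem measurableSet_Ioo] with u hu
  exact (derivWithin_reflect_eq hu).symm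

theorem ConvexOn.ae_derivWithin_reflect_mem_Icc (hf : ConvexOn ℝ (Icc 0 1) f)
    (h0 : HasDerivWithinAt f d₀ (Icc 0 1) 0) (h1 : HasDerivWithinAt f d₁ (Icc 0 1) 1) :
    ∀ᵐ u ∂(volume.restrict (Ioo (0 : ℝ) 1)), derivWithin f (Icc 0 1) (1 - u) ∈ Icc d₀ d₁ := by
  rw [ae_restrict_iff' measurableSet_Ioo]
  have h := (volume.measurePreserving_sub_left (1 : ℝ)).quasiMeasurePreserving.ae
    (hf.ae_deriv_mem_Icc h0 h1)
  filter_upwards [h] with u hu hu01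
  rw [derivWithin_reflect_eq hu01]
  exact hu (one_sub_mem_Ioo hu01)

theorem ConvexOn.integral_derivWithin_reflect (hf : ConvexOn ℝ (Icc 0 1) f)
    (h0 : HasDerivWithinAt f d₀ (Icc 0 1) 0) (h1 : HasDerivWithinAt f d₁ (Icc 0 1) 1) :
    ∫ u in Ioo (0 : ℝ) 1, derivWithin f (Icc 0 1) (1 - u) = f 1 - f 0 := by
  rw [setIntegral_congr_fun measurableSet_Ioo fun u hu => derivWithin_reflect_eq (f := f) hu,
    ← integral_Ioc_eq_integral_Ioo, ← intervalIntegral.integral_of_le zero_le_one,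
    intervalIntegral.integral_comp_sub_left (fun x => deriv f x) 1, sub_self, sub_zero,
    (hf.absolutelyContinuousOnInterval h0 h1).integral_deriv_eq_sub]

theorem ConvexOn.integrable_derivWithin_reflect (hf : ConvexOn ℝ (Icc 0 1) f)
    (h0 : HasDerivWithinAt f d₀ (Icc 0 1) 0) (h1 : HasDerivWithinAt f d₁ (Icc 0 1) 1) :
    Integrable (fun u => derivWithin f (Icc 0 1) (1 - u)) (volume.restrict (Ioo (0 : ℝ) 1)) := by
  refine Integrable.of_bound aestronglyMeasurable_derivWithin_reflect (max |d₀| |d₁|) ?_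
  filter_upwards [hf.ae_derivWithin_reflect_mem_Icc h0 h1] with u hu
  exact abs_le_max_abs_abs hu.1 hu.2

theorem convex_distortionSet (β : ℝ) : Convex ℝ (distortionSet β) := by
  rintro f ⟨hf, hfm, hf0, hf1, d₀, d₁, hd0, hd1, hd⟩ g ⟨hg, hgm, hg0, hg1, c₀, c₁, hc0, hc1, hc⟩
    a b ha hb hab
  refine ⟨(hf.smul ha).add (hg.smul hb), fun x hx => ?_, by simp [hf0, hg0], by simp [hf1, hg1, hab],
    a * d₀ + b * c₀, a * d₁ + b * c₁, (hd0.const_mul a).add (hc0.const_mul b),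
    (hd1.const_mul a).add (hc1.const_mul b), ?_⟩
  · exact (convex_Icc (0 : ℝ) 1) (hfm hx) (hgm hx) ha hb hab
  · nlinarith [mul_le_mul_of_nonneg_left hd ha, mul_le_mul_of_nonneg_left hc hb]

theorem id_mem_distortionSet {β : ℝ} (hβ : 1 ≤ β) : (fun t : ℝ => t) ∈ distortionSet β :=
  ⟨convexOn_id (convex_Icc 0 1), fun _ h => h, rfl, rfl, 1, 1, hasDerivWithinAt_id _ _,
    hasDerivWithinAt_id _ _, by linarith⟩

/-- The distortion with slope `c` before `1 - p` and slope `c * β` after `1 - p`. -/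
noncomputable def kinkedDistortion (β c : ℝ) (t : ℝ) : ℝ := max (c * t) (1 - c * β * (1 - t))

/-- The hypothesis `h` says that the two affine pieces meet at `1 - p`; as `c ≤ c * β`, the flatter
one dominates to the left. -/
theorem kinkedDistortion_eq_left {β c p t : ℝ} (hβ : 1 ≤ β) (hc : 0 < c)
    (h : c * (β * p + (1 - p)) = 1) (ht : t ≤ 1 - p) : kinkedDistortion β c t = c * t := by
  refine max_eq_left ?_
  nlinarith [mul_nonneg (mul_nonneg hc.le (sub_nonneg.2 hβ)) (sub_nonneg.2 ht)]

theorem kinkedDistortion_eq_right {β c p t : ℝ} (hβ : 1 ≤ β) (hc : 0 < c)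
    (h : c * (β * p + (1 - p)) = 1) (ht : 1 - p ≤ t) :
    kinkedDistortion β c t = 1 - c * β * (1 - t) := by
  refine max_eq_right ?_
  nlinarith [mul_nonneg (mul_nonneg hc.le (sub_nonneg.2 hβ)) (sub_nonneg.2 ht)]

theorem hasDerivAt_kinkedDistortion_left {β c p t : ℝ} (hβ : 1 ≤ β) (hc : 0 < c)
    (h : c * (β * p + (1 - p)) = 1) (ht : t < 1 - p) :
    HasDerivAt (kinkedDistortion β c) c t := by
  have h1 : HasDerivAt (fun t : ℝ => c * t) c t := by
    simpa using (hasDerivAt_id t).const_mul c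
  refine h1.congr_of_eventuallyEq ?_
  filter_upwards [Iio_mem_nhds ht] with s hs
  exact kinkedDistortion_eq_left hβ hc h (le_of_lt hs)

theorem hasDerivAt_kinkedDistortion_right {β c p t : ℝ} (hβ : 1 ≤ β) (hc : 0 < c)
    (h : c * (β * p + (1 - p)) = 1) (ht : 1 - p < t) :
    HasDerivAt (kinkedDistortion β c) (c * β) t := by
  have h1 : HasDerivAt (fun t : ℝ => 1 - c * β * (1 - t)) (c * β) t := by
    simpa using (((hasDerivAt_id t).const_sub 1).const_mul (c * β)).const_sub 1
  refine h1.congr_of_eventuallyEq ?_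
  filter_upwards [Ioi_mem_nhds ht] with s hs
  exact kinkedDistortion_eq_right hβ hc h (le_of_lt hs)

theorem kinkedDistortion_mem_distortionSet {β c p : ℝ} (hβ : 1 ≤ β) (hc : 0 < c)
    (hp : p ∈ Ioo (0 : ℝ) 1) (h : c * (β * p + (1 - p)) = 1) :
    kinkedDistortion β c ∈ distortionSet β := by
  have hc1 : c ≤ 1 := by nlinarith [mul_nonneg hc.le (mul_nonneg (sub_nonneg.2 hβ) hp.1.le)]
  have hcβ : 0 ≤ c * β := by positivity
  refine ⟨?_, fun t ht => ⟨?_, ?_⟩, ?_, ?_, c, c * β,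
    (hasDerivAt_kinkedDistortion_left hβ hc h (by linarith [hp.2])).hasDerivWithinAt,
    (hasDerivAt_kinkedDistortion_right hβ hc h (by linarith [hp.1])).hasDerivWithinAt, by
      rw [mul_comm]⟩
  · refine ConvexOn.sup ⟨convex_Icc 0 1, fun x _ y _ a b _ _ _ => ?_⟩
      ⟨convex_Icc 0 1, fun x _ y _ a b _ _ hab => ?_⟩
    · simp only [smul_eq_mul]; apply le_of_eq; ring
    · simp only [smul_eq_mul]
      obtain rfl : b = 1 - a := by linarith
      apply le_of_eq; ring
  · exact (mul_nonneg hc.le ht.1).trans (le_max_left _ _)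
  · exact max_le (by nlinarith [ht.1, ht.2])
      (by linarith [mul_nonneg hcβ (sub_nonneg.2 ht.2)])
  · rw [kinkedDistortion_eq_left hβ hc h (by linarith [hp.2]), mul_zero]
  · rw [kinkedDistortion_eq_right hβ hc h (by linarith [hp.1])]; ring

end Distortion

/-! ### The dual representation -/

section Representation

variable {q : ℝ → ℝ} {M β e : ℝ}

theorem integrable_quantile_mul_derivWithin
    (hqm : AEMeasurable q (volume.restrict (Ioo (0 : ℝ) 1)))
    (hqM : ∀ᵐ u ∂(volume.restrict (Ioo (0 : ℝ) 1)), ‖q u‖ ≤ M) {f : ℝ → ℝ}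
    (hf : f ∈ distortionSet β) :
    Integrable (fun u => q u * derivWithin f (Icc 0 1) (1 - u))
      (volume.restrict (Ioo (0 : ℝ) 1)) := by
  obtain ⟨hf, -, -, -, d₀, d₁, hd0, hd1, -⟩ := hf
  exact (hf.integrable_derivWithin_reflect hd0 hd1).bdd_mul hqm.aestronglyMeasurable hqM

/-- The weight has total mass `f 1 - f 0 = 1`, so `q` can be centred at `e`. -/
theorem integral_quantile_mul_derivWithin
    (hqm : AEMeasurable q (volume.restrict (Ioo (0 : ℝ) 1)))
    (hqM : ∀ᵐ u ∂(volume.restrict (Ioo (0 : ℝ) 1)), ‖q u‖ ≤ M) {f : ℝ → ℝ}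
    (hf : f ∈ distortionSet β) (e : ℝ) :
    ∫ u in Ioo (0 : ℝ) 1, q u * derivWithin f (Icc 0 1) (1 - u) =
      e + ∫ u in Ioo (0 : ℝ) 1, (q u - e) * derivWithin f (Icc 0 1) (1 - u) := by
  have hi := integrable_quantile_mul_derivWithin hqm hqM hf
  obtain ⟨hf, -, hf0, hf1, d₀, d₁, hd0, hd1, -⟩ := hf
  have hg := hf.integrable_derivWithin_reflect hd0 hd1
  simp only [sub_mul]
  rw [integral_sub hi (hg.const_mul e), integral_const_mul,
    hf.integral_derivWithin_reflect hd0 hd1, hf0, hf1]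
  ring

theorem integrable_max_sub_of_ae_norm_le
    (hqm : AEMeasurable q (volume.restrict (Ioo (0 : ℝ) 1)))
    (hqM : ∀ᵐ u ∂(volume.restrict (Ioo (0 : ℝ) 1)), ‖q u‖ ≤ M) (e : ℝ) :
    Integrable (fun u => max (q u - e) 0) (volume.restrict (Ioo (0 : ℝ) 1)) ∧
      Integrable (fun u => max (e - q u) 0) (volume.restrict (Ioo (0 : ℝ) 1)) := by
  have hq : Integrable q (volume.restrict (Ioo (0 : ℝ) 1)) :=
    Integrable.of_bound hqm.aestronglyMeasurable M hqM
  exact ⟨(hq.sub (integrable_const e)).pos_part, ((integrable_const e).sub hq).pos_part⟩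

theorem le_integral_quantile_mul_derivWithin
    (hqm : AEMeasurable q (volume.restrict (Ioo (0 : ℝ) 1)))
    (hqM : ∀ᵐ u ∂(volume.restrict (Ioo (0 : ℝ) 1)), ‖q u‖ ≤ M)
    (he : ∫ u in Ioo (0 : ℝ) 1, max (q u - e) 0 = β * ∫ u in Ioo (0 : ℝ) 1, max (e - q u) 0)
    {f : ℝ → ℝ} (hf : f ∈ distortionSet β) :
    e ≤ ∫ u in Ioo (0 : ℝ) 1, q u * derivWithin f (Icc 0 1) (1 - u) := by
  rw [integral_quantile_mul_derivWithin hqm hqM hf e]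
  have hi := integrable_quantile_mul_derivWithin hqm hqM hf
  obtain ⟨hA, hB⟩ := integrable_max_sub_of_ae_norm_le hqm hqM e
  obtain ⟨hf, -, hf0, hf1, d₀, d₁, hd0, hd1, hd⟩ := hf
  have hg := hf.integrable_derivWithin_reflect hd0 hd1
  have hi' : Integrable (fun u => (q u - e) * derivWithin f (Icc 0 1) (1 - u))
      (volume.restrict (Ioo (0 : ℝ) 1)) := by
    simp only [sub_mul]
    exact hi.sub (hg.const_mul e)
  have key : ∫ u in Ioo (0 : ℝ) 1, (d₀ * max (q u - e) 0 - d₁ * max (e - q u) 0) ≤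
      ∫ u in Ioo (0 : ℝ) 1, (q u - e) * derivWithin f (Icc 0 1) (1 - u) := by
    refine integral_mono_ae ((hA.const_mul _).sub (hB.const_mul _)) hi' ?_
    filter_upwards [hf.ae_derivWithin_reflect_mem_Icc hd0 hd1] with u hu
    rcases le_total (q u) e with h | h
    · rw [max_eq_right (sub_nonpos.2 h), max_eq_left (sub_nonneg.2 h)]
      nlinarith [mul_le_mul_of_nonneg_left hu.2 (sub_nonneg.2 h)]
    · rw [max_eq_left (sub_nonneg.2 h), max_eq_right (sub_nonpos.2 h)]
      nlinarith [mul_le_mul_of_nonneg_left hu.1 (sub_nonneg.2 h)]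
  rw [integral_sub (hA.const_mul _) (hB.const_mul _), integral_const_mul, integral_const_mul,
    he] at key
  have hB0 : 0 ≤ ∫ u in Ioo (0 : ℝ) 1, max (e - q u) 0 :=
    integral_nonneg fun _ => le_max_right _ _
  -- The lower bound in `key` is now `(β d₀ - d₁) ∫ (e - q)⁺`.
  nlinarith [mul_le_mul_of_nonneg_right hd hB0]

/-- A distortion whose reflected derivative is `c * β` where `q ≤ e` and `c` where `q ≥ e` attains
the bound. -/
theorem integral_quantile_mul_derivWithin_eq
    (hqm : AEMeasurable q (volume.restrict (Ioo (0 : ℝ) 1)))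
    (hqM : ∀ᵐ u ∂(volume.restrict (Ioo (0 : ℝ) 1)), ‖q u‖ ≤ M)
    (he : ∫ u in Ioo (0 : ℝ) 1, max (q u - e) 0 = β * ∫ u in Ioo (0 : ℝ) 1, max (e - q u) 0)
    {f : ℝ → ℝ} (hf : f ∈ distortionSet β) {c : ℝ}
    (hc : ∀ᵐ u ∂(volume.restrict (Ioo (0 : ℝ) 1)),
      (q u ≤ e ∧ derivWithin f (Icc 0 1) (1 - u) = c * β) ∨
        (e ≤ q u ∧ derivWithin f (Icc 0 1) (1 - u) = c)) :
    ∫ u in Ioo (0 : ℝ) 1, q u * derivWithin f (Icc 0 1) (1 - u) = e := by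
  obtain ⟨hA, hB⟩ := integrable_max_sub_of_ae_norm_le hqm hqM e
  have key : ∫ u in Ioo (0 : ℝ) 1, (q u - e) * derivWithin f (Icc 0 1) (1 - u) =
      ∫ u in Ioo (0 : ℝ) 1, (c * max (q u - e) 0 - c * β * max (e - q u) 0) := by
    refine integral_congr_ae ?_
    filter_upwards [hc] with u hu
    rcases hu with ⟨h, hu⟩ | ⟨h, hu⟩
    · rw [max_eq_right (sub_nonpos.2 h), max_eq_left (sub_nonneg.2 h), hu]; ring
    · rw [max_eq_left (sub_nonneg.2 h), max_eq_right (sub_nonpos.2 h), hu]; ring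
  rw [integral_quantile_mul_derivWithin hqm hqM hf e, key,
    integral_sub (hA.const_mul _) (hB.const_mul _), integral_const_mul, integral_const_mul, he]
  ring

/-- If `q` does not cross `e`, the first-order condition forces `q = e` almost everywhere. -/
theorem ae_eq_of_first_order_condition
    (hqm : AEMeasurable q (volume.restrict (Ioo (0 : ℝ) 1)))
    (hqM : ∀ᵐ u ∂(volume.restrict (Ioo (0 : ℝ) 1)), ‖q u‖ ≤ M) (hβ : 1 ≤ β)
    (he : ∫ u in Ioo (0 : ℝ) 1, max (q u - e) 0 = β * ∫ u in Ioo (0 : ℝ) 1, max (e - q u) 0)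
    (h : (∀ u ∈ Ioo (0 : ℝ) 1, e ≤ q u) ∨ ∀ u ∈ Ioo (0 : ℝ) 1, q u ≤ e) :
    ∀ᵐ u ∂(volume.restrict (Ioo (0 : ℝ) 1)), q u = e := by
  obtain ⟨hA, hB⟩ := integrable_max_sub_of_ae_norm_le hqm hqM e
  have hz : (∫ u in Ioo (0 : ℝ) 1, max (q u - e) 0) = 0 ∧
      (∫ u in Ioo (0 : ℝ) 1, max (e - q u) 0) = 0 := by
    rcases h with h | h
    · have h0 : (∫ u in Ioo (0 : ℝ) 1, max (e - q u) 0) = 0 :=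
        setIntegral_eq_zero_of_forall_eq_zero fun u hu => max_eq_right (sub_nonpos.2 (h u hu))
      exact ⟨by rw [he, h0, mul_zero], h0⟩
    · have h0 : (∫ u in Ioo (0 : ℝ) 1, max (q u - e) 0) = 0 :=
        setIntegral_eq_zero_of_forall_eq_zero fun u hu => max_eq_right (sub_nonpos.2 (h u hu))
      refine ⟨h0, ?_⟩
      rw [h0] at he
      exact (mul_eq_zero.1 he.symm).resolve_left (by linarith)
  have h1 := (integral_eq_zero_iff_of_nonneg (fun _ => le_max_right _ _) hA).1 hz.1
  have h2 := (integral_eq_zero_iff_of_nonneg (fun _ => le_max_right _ _) hB).1 hz.2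
  filter_upwards [h1, h2] with u hu1 hu2
  exact le_antisymm (sub_nonpos.1 (max_eq_right_iff.1 hu1)) (sub_nonpos.1 (max_eq_right_iff.1 hu2))

theorem exists_distortion_integral_eq
    (hqm : AEMeasurable q (volume.restrict (Ioo (0 : ℝ) 1)))
    (hqM : ∀ᵐ u ∂(volume.restrict (Ioo (0 : ℝ) 1)), ‖q u‖ ≤ M) (hβ : 1 ≤ β)
    (he : ∫ u in Ioo (0 : ℝ) 1, max (q u - e) 0 = β * ∫ u in Ioo (0 : ℝ) 1, max (e - q u) 0)
    {p : ℝ} (hp : p ∈ Icc (0 : ℝ) 1) (hlt : ∀ u ∈ Ioo (0 : ℝ) 1, u < p → q u ≤ e)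
    (hgt : ∀ u ∈ Ioo (0 : ℝ) 1, p < u → e ≤ q u) :
    ∃ f ∈ distortionSet β, ∫ u in Ioo (0 : ℝ) 1, q u * derivWithin f (Icc 0 1) (1 - u) = e := by
  by_cases hp' : p ∈ Ioo (0 : ℝ) 1
  · have hpos : 0 < β * p + (1 - p) := by nlinarith [hp'.1, hp'.2]
    have hc : 0 < (β * p + (1 - p))⁻¹ := inv_pos.2 hpos
    have h := inv_mul_cancel₀ hpos.ne'
    have hmem := kinkedDistortion_mem_distortionSet hβ hc hp' h
    refine ⟨_, hmem, integral_quantile_mul_derivWithin_eq hqm hqM he hmem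
      (c := (β * p + (1 - p))⁻¹) ?_⟩
    filter_upwards [ae_restrict_mem measurableSet_Ioo,
      ae_restrict_of_ae (Measure.ae_ne volume p)] with u hu hup
    rw [derivWithin_reflect_eq hu]
    rcases lt_or_gt_of_ne hup with h' | h'
    · exact Or.inl ⟨hlt u hu h',
        (hasDerivAt_kinkedDistortion_right hβ hc h (by linarith)).deriv⟩
    · exact Or.inr ⟨hgt u hu h',
        (hasDerivAt_kinkedDistortion_left hβ hc h (by linarith)).deriv⟩
  -- For `p` equal to 0 or 1 there is no interior kink, but then `q = e` almost everywhere and the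
  -- identity distortion suffices.
  · have hside : (∀ u ∈ Ioo (0 : ℝ) 1, e ≤ q u) ∨ ∀ u ∈ Ioo (0 : ℝ) 1, q u ≤ e := by
      rcases hp.1.eq_or_lt with h0 | h0
      · exact Or.inl fun u hu => hgt u hu (h0 ▸ hu.1)
      · have h1 : p = 1 := le_antisymm hp.2 (not_lt.1 fun h => hp' ⟨h0, h⟩)
        exact Or.inr fun u hu => hlt u hu (h1 ▸ hu.2)
    have hmem := id_mem_distortionSet hβ
    refine ⟨_, hmem, integral_quantile_mul_derivWithin_eq hqm hqM he hmem (c := 1) ?_⟩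
    filter_upwards [ae_restrict_mem measurableSet_Ioo,
      ae_eq_of_first_order_condition hqm hqM hβ he hside] with u hu hue
    exact Or.inr ⟨hue.ge, by rw [derivWithin_reflect_eq hu]; exact deriv_id _⟩

end Representation

theorem mainTheorem5 {Ω : Type*} [MeasurableSpace Ω] (P : Measure Ω) [IsProbabilityMeasure P]
    (τ : ℝ) (hτ₀ : 0 < τ) (hτ₁ : τ ≤ 1 / 2)
    (ξ : Ω → ℝ) (hξ : MemLp ξ ⊤ P)
    (q : ℝ → ℝ) (hq : IsQuantileFunction P ξ q) :
    -- the expectile is well defined: it is the unique minimiser of the loss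
    (∀ l : ℝ, l ≠ expectile P τ ξ →
      expectileLoss P τ ξ (expectile P τ ξ) < expectileLoss P τ ξ l) ∧
    -- the set of distortions is convex
    Convex ℝ (distortionSet ((1 - τ) / τ)) ∧
    -- all the integrals exist
    (∀ f ∈ distortionSet ((1 - τ) / τ),
      IntervalIntegrable (fun u => q u * derivWithin f (Icc 0 1) (1 - u)) volume 0 1) ∧
    -- the expectile is the infimum of these integrals
    IsGLB {x : ℝ | ∃ f ∈ distortionSet ((1 - τ) / τ),
        x = ∫ u in (0 : ℝ)..1, q u * derivWithin f (Icc 0 1) (1 - u)}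
      (expectile P τ ξ) := by

  set β := (1 - τ) / τ with hβ_def
  have hβ : 1 ≤ β := by rw [hβ_def, le_div_iff₀ hτ₀]; linarith
  have hξm : AEMeasurable ξ P := hξ.1.aemeasurable
  obtain ⟨M, hM⟩ := exists_ae_norm_le_of_memLp_top hξ
  obtain ⟨e, he⟩ := exists_first_order_condition hξ hτ₀ (by linarith)
  rw [expectile_eq_of_first_order_condition hξ hτ₀ hτ₁ he]
  have hqm := hq.aemeasurable
  have hqM := hq.ae_norm_le hξm hM
  have heq : ∫ u in Ioo (0 : ℝ) 1, max (q u - e) 0 =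
      β * ∫ u in Ioo (0 : ℝ) 1, max (e - q u) 0 := by
    rw [hq.integral_comp hξm (φ := fun x => max (x - e) 0) (by fun_prop),
      hq.integral_comp hξm (φ := fun x => max (e - x) 0) (by fun_prop), hβ_def,
      div_mul_eq_mul_div, eq_div_iff hτ₀.ne', ← he, mul_comm]
  have hint : ∀ f : ℝ → ℝ, ∫ u in (0 : ℝ)..1, q u * derivWithin f (Icc 0 1) (1 - u) =
      ∫ u in Ioo (0 : ℝ) 1, q u * derivWithin f (Icc 0 1) (1 - u) := fun f => by
    rw [intervalIntegral.integral_of_le zero_le_one, integral_Ioc_eq_integral_Ioo]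
  refine ⟨fun l hl => ?_, convex_distortionSet β, fun f hf => ?_, IsLeast.isGLB ⟨?_, ?_⟩⟩
  · have h1 := expectileLoss_lower_bound hξ hτ₁ he l
    have h2 : 0 < τ * (l - e) ^ 2 := mul_pos hτ₀ (by have := sub_ne_zero.2 hl; positivity)
    linarith
  · rw [intervalIntegrable_iff_integrableOn_Ioo_of_le zero_le_one]
    exact integrable_quantile_mul_derivWithin hqm hqM hf
  -- The crossing level is `p = P[ξ < e]`: `e < q u` would give `p ≤ P[ξ < q u] ≤ u`, and `q u < e`
  -- would give `u ≤ p`.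
  · obtain ⟨f, hf, hfe⟩ := exists_distortion_integral_eq hqm hqM hβ heq
      (p := P.real {ω | ξ ω < e}) ⟨measureReal_nonneg, measureReal_le_one⟩
      (fun u hu hup => not_lt.1 fun h => absurd hup (not_lt.2
        ((measureReal_mono fun ω (hω : ξ ω < e) => hω.trans h).trans (hq u hu).1)))
      (fun u hu hup => not_lt.1 fun h => absurd hup (not_lt.2 (hq.le_of_lt hu h)))
    exact ⟨f, hf, by rw [hint, hfe]⟩
  · rintro x ⟨f, hf, rfl⟩
    rw [hint]
    exact le_integral_quantile_mul_derivWithin hqm hqM heq hf
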